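/- Let $\Omega\subset\mathbb R^2$ be a bounded domain (nonempty, open, connected) with smooth boundary and area $|\Omega|=\pi$. For $u\in H^1_0(\Omega)$ put $$I_{8\pi}(u,\Omega)=\frac1{16\pi}\int_\Omega|\nabla u|^2\,dx-\ln\Big(\frac1{|\Omega|}\int_\Omega e^u\,dx\Big),\qquad E_{8\pi}(\Omega)=\inf_{u\in H^1_0(\Omega)}I_{8\pi}(u,\Omega).$$ Let $G(x,y)$ be the Green's function of $\Omega$, that is, $-\Delta_xG(\cdot,y)=\delta_y$ in $\Omega$ and $G(\cdot,y)=0$ on $\partial\Omega$ for each $y\in\Omega$. Let $\gamma(x,y)=G(x,y)-\frac1{2\pi}\ln\frac1{|x-y|}$ be its regular part, extended continuously to $x=y$, and put $\gamma(\Omega)=\sup_{x\in\Omega}\gamma(x,x)$. Then $$E_{8\pi}(\Omega)\le-1-4\pi\gamma(\Omega).$$ -/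

import Mathlib

open MeasureTheory Set Filter Topology Laplacian
open scoped ContDiff

/-- The Euclidean plane. -/
abbrev Plane : Type := EuclideanSpace ℝ (Fin 2)

/-- The boundary of `Ω` is smooth: near each of its points, `Ω` is the sublevel set `{ρ < 0}` of a
smooth function `ρ` with nonvanishing differential at that point. -/
def HasSmoothBoundary (Ω : Set Plane) : Prop :=
  ∀ p ∈ frontier Ω, ∃ (U : Set Plane) (ρ : Plane → ℝ), IsOpen U ∧ p ∈ U ∧
    ContDiffOn ℝ ∞ ρ U ∧ fderiv ℝ ρ p ≠ 0 ∧ Ω ∩ U = {x ∈ U | ρ x < 0}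

/-- A bounded domain (nonempty connected open set) of the plane with smooth boundary. -/
structure IsBoundedSmoothDomain (Ω : Set Plane) : Prop where
  isOpen : IsOpen Ω
  isConnected : IsConnected Ω
  isBounded : Bornology.IsBounded Ω
  smooth_boundary : HasSmoothBoundary Ω

/-- `φ ∈ C_c^∞(Ω)`, extended by zero to the plane. -/
structure IsTestFunction (Ω : Set Plane) (φ : Plane → ℝ) : Prop where
  smooth : ContDiff ℝ ∞ φ
  compact_support : HasCompactSupport φ
  support_subset : tsupport φ ⊆ Ω

/-- `Du` is the weak gradient of `u` in `Ω`: `∫_Ω u ∂ᵢφ = - ∫_Ω φ (Du)ᵢ` for `φ ∈ C_c^∞(Ω)`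
(both components at once). -/
def HasWeakGradient (Ω : Set Plane) (u : Plane → ℝ) (Du : Plane → Plane) : Prop :=
  ∀ φ : Plane → ℝ, IsTestFunction Ω φ →
    ∫ x in Ω, u x • gradient φ x = - ∫ x in Ω, φ x • Du x

/-- `u ∈ H¹₀(Ω)` with weak gradient `Du`: `u` and `Du` are square integrable on `Ω`, and `u` is a
limit of functions of `C_c^∞(Ω)` in the norm of `H¹(Ω)`. -/
structure MemH10 (Ω : Set Plane) (u : Plane → ℝ) (Du : Plane → Plane) : Prop where
  memLp : MemLp u 2 (volume.restrict Ω)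
  memLp_grad : MemLp Du 2 (volume.restrict Ω)
  weak_gradient : HasWeakGradient Ω u Du
  approx : ∃ φ : ℕ → Plane → ℝ, (∀ n, IsTestFunction Ω (φ n)) ∧
    Tendsto (fun n => eLpNorm (fun x => φ n x - u x) 2 (volume.restrict Ω)) atTop (𝓝 0) ∧
    Tendsto (fun n => eLpNorm (fun x => gradient (φ n) x - Du x) 2 (volume.restrict Ω))
      atTop (𝓝 0)

/-- `I_λ(u, Ω) = (1 / (2λ)) ∫_Ω |∇u|² - ln ((1 / |Ω|) ∫_Ω e^u)`, where `Du` stands for `∇u`. On a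
bounded domain `e^u` is integrable for each `u ∈ H¹₀(Ω)`. -/
noncomputable def meanFieldFunctional (lam : ℝ) (Ω : Set Plane) (u : Plane → ℝ)
    (Du : Plane → Plane) : ℝ :=
  1 / (2 * lam) * (∫ x in Ω, ‖Du x‖ ^ 2)
    - Real.log (1 / volume.real Ω * ∫ x in Ω, Real.exp (u x))

/-- `E_λ(Ω)`, the infimum of `I_λ(u, Ω)` over `u ∈ H¹₀(Ω)`, taken in the extended reals. -/
noncomputable def meanFieldEnergy (lam : ℝ) (Ω : Set Plane) : EReal :=
  ⨅ (u : Plane → ℝ) (Du : Plane → Plane) (_ : MemH10 Ω u Du),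
    ((meanFieldFunctional lam Ω u Du : ℝ) : EReal)

/-- `g = G(·, y)` is the Green's function of `Ω` with pole `y`: `-Δg = δ_y` in `Ω` in the sense of
distributions, `g` is continuous up to the boundary away from the pole, and `g = 0` on `∂Ω`. -/
structure IsGreenFunction (Ω : Set Plane) (y : Plane) (g : Plane → ℝ) : Prop where
  locallyIntegrable : LocallyIntegrableOn g Ω
  neg_laplacian_eq_dirac : ∀ φ : Plane → ℝ, IsTestFunction Ω φ →
    ∫ x in Ω, g x * -(Δ φ) x = φ y
  continuousOn : ContinuousOn g (closure Ω \ {y})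
  eq_zero_on_boundary : ∀ x ∈ frontier Ω, g x = 0

/-- `t = γ(y, y)`, where `γ(x, y) = G(x, y) - (1 / (2π)) ln (1 / |x - y|)` is the regular part of the
Green's function `G` of `Ω`; on the diagonal it is the limit as `x → y`. -/
def IsRegularPartAt (Ω : Set Plane) (y : Plane) (t : ℝ) : Prop :=
  ∃ g : Plane → ℝ, IsGreenFunction Ω y g ∧
    Tendsto (fun x => g x - 1 / (2 * Real.pi) * Real.log (1 / ‖x - y‖)) (𝓝[≠] y) (𝓝 t)

/-- `γ(Ω) = sup_{y ∈ Ω} γ(y, y)`, taken in the extended reals. -/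
noncomputable def gammaSup (Ω : Set Plane) : EReal :=
  ⨆ (y : Plane) (_ : y ∈ Ω) (t : ℝ) (_ : IsRegularPartAt Ω y t), (t : EReal)

/-!
The bound comes from transplanting the bubble of the unit disc. On the disc, `s = -(1/2π) ln |x|`
is the Green's function with pole `0`, and the functions `bubble δ s = 2 ln ((1 + δ)/(|x|² + δ))`
have energies tending to `-1` as `δ → 0`. On `Ω`, with Green's function `g` and pole `y`, the
competitor is `bubble δ ∘ g`.

* Dirichlet integral. If `F' = (m')²` and `F = 0` near `0`, then `|∇(m ∘ g)|² = ∇(F ∘ g) · ∇g`, so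
  testing `-Δg = δ_y` against `F ∘ g` gives `∫ |∇(m ∘ g)|² ≤ sup F`, the same value as on the disc.
* Exponential integral. Near `y` one has `exp (-4πg) ≈ e^{-4πt} |x - y|²` with `t = γ(y, y)`, so
  `∫ exp (m ∘ g)` is at least an explicit radial integral (`integral_ball_bubble`) which exceeds the
  one of the disc by the factor `e^{4πt}`, up to `o(1)`. This is the source of `-4πγ(y, y)`.

No regularity of `g` beyond its definition is needed, in particular not Weyl's lemma: `g` is
extended by zero and mollified, and `m` vanishes for `s ≤ s₁ / 2`. Since `g` vanishes on `∂Ω`,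
composing `m` with the mollified `g` yields a function of `C_c^∞(Ω)`
(`IsGreenFunction.exists_isCompact_superlevel`), for which the first item holds with the
mollifier in place of `δ_y` (`IsGreenFunction.integral_norm_gradient_sq_le`). Dominated convergence
then removes the mollification (`IsGreenFunction.meanFieldEnergy_le`). The cutoff near `s = 0` is
applied to the derivative of the bubble (`exists_truncated_bubble`): it does not increase the
Dirichlet integral, and it lowers the profile by at most `bubble δ s₁`, which tends to `0` with `s₁`.
-/

/-! ### Gradient and Laplacian in coordinates -/

theorem norm_gradient_sq_eq_sum (f : Plane → ℝ) (x : Plane) :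
    ‖gradient f x‖ ^ 2 = ∑ i, (fderiv ℝ f x (EuclideanSpace.basisFun (Fin 2) ℝ i)) ^ 2 := by
  rw [← (EuclideanSpace.basisFun (Fin 2) ℝ).sum_sq_norm_inner_left (gradient f x)]
  refine Finset.sum_congr rfl fun i _ => ?_
  rw [gradient, InnerProductSpace.toDual_symm_apply, Real.norm_eq_abs, sq_abs]

theorem laplacian_eq_sum_fderiv {f : Plane → ℝ} (hf : ContDiff ℝ 2 f) (x : Plane) :
    (Δ f) x = ∑ i, fderiv ℝ (fun z => fderiv ℝ f z (EuclideanSpace.basisFun (Fin 2) ℝ i)) x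
      (EuclideanSpace.basisFun (Fin 2) ℝ i) := by
  have hd : DifferentiableAt ℝ (fderiv ℝ f) x :=
    ((hf.fderiv_right (m := 1) (by norm_num)).differentiable (by norm_num)) x
  rw [InnerProductSpace.laplacian_eq_iteratedFDeriv_orthonormalBasis f
    (EuclideanSpace.basisFun (Fin 2) ℝ)]
  refine Finset.sum_congr rfl fun i _ => ?_
  rw [iteratedFDeriv_two_apply, fderiv_clm_apply hd (differentiableAt_const _)]
  simp

theorem laplacian_comp_const_sub {f : Plane → ℝ} (hf : ContDiff ℝ 2 f) (a x : Plane) :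
    (Δ (fun z => f (a - z))) x = (Δ f) (a - x) := by
  have h1 {g : Plane → ℝ} (hg : Differentiable ℝ g) (z v : Plane) :
      fderiv ℝ (fun z => g (a - z)) z v = - fderiv ℝ g (a - z) v := by
    have h := (hg (a - z)).hasFDerivAt.comp z ((hasFDerivAt_id z).const_sub a)
    have h' : HasFDerivAt (fun z => g (a - z)) _ z := h
    rw [h'.fderiv]
    simp
  have hd (v : Plane) : Differentiable ℝ (fun z => fderiv ℝ f z v) :=
    ((hf.fderiv_right (m := 1) (by norm_num)).clm_apply contDiff_const).differentiable
      (by norm_num)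
  have hs : ContDiff ℝ 2 (fun z => f (a - z)) := hf.comp (contDiff_const.sub contDiff_id)
  rw [laplacian_eq_sum_fderiv hf, laplacian_eq_sum_fderiv hs]
  refine Finset.sum_congr rfl fun i _ => ?_
  simp only [h1 (hf.differentiable (by norm_num))]
  rw [fderiv_fun_neg, neg_apply, h1 (hd _), neg_neg]

/-! ### Mollification -/

/-- The convolution of `G` with the kernel `ρ`. -/
noncomputable def mollification (ρ G : Plane → ℝ) (x : Plane) : ℝ :=
  ∫ z, G z * ρ (x - z)

section Mollification

variable {ρ G : Plane → ℝ}

theorem contDiff_mollification (hρ : ContDiff ℝ ∞ ρ) (hc : HasCompactSupport ρ)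
    (hG : LocallyIntegrable G) : ContDiff ℝ ∞ (mollification ρ G) :=
  hc.contDiff_convolution_right (ContinuousLinearMap.mul ℝ ℝ) hG hρ

theorem fderiv_mollification_apply (hρ : ContDiff ℝ 1 ρ) (hc : HasCompactSupport ρ)
    (hG : LocallyIntegrable G) (x v : Plane) :
    fderiv ℝ (mollification ρ G) x v = mollification (fun z => fderiv ℝ ρ z v) G x := by
  have h := hc.hasFDerivAt_convolution_right (ContinuousLinearMap.mul ℝ ℝ) hG hρ x
  have h' := convolution_precompR_apply (ContinuousLinearMap.mul ℝ ℝ) hG (hc.fderiv (𝕜 := ℝ))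
    (hρ.continuous_fderiv (by norm_num)) x v
  have : HasFDerivAt (mollification ρ G) _ x := h
  rw [this.fderiv, h']
  rfl

theorem laplacian_mollification (hρ : ContDiff ℝ ∞ ρ) (hc : HasCompactSupport ρ)
    (hG : LocallyIntegrable G) (x : Plane) :
    (Δ (mollification ρ G)) x = ∫ z, G z * (Δ (fun w => ρ (x - w))) z := by
  have h2 : ContDiff ℝ 2 ρ := contDiff_infty.1 hρ 2
  have hd (v : Plane) : ContDiff ℝ 1 (fun z => fderiv ℝ ρ z v) :=
    (h2.fderiv_right (m := 1) (by norm_num)).clm_apply contDiff_const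
  have hcd (v : Plane) : HasCompactSupport (fun z => fderiv ℝ ρ z v) := hc.fderiv_apply (𝕜 := ℝ) v
  rw [laplacian_eq_sum_fderiv (contDiff_infty.1 (contDiff_mollification hρ hc hG) 2)]
  simp only [fderiv_mollification_apply (h2.of_le (by norm_num)) hc hG]
  simp only [fderiv_mollification_apply (hd _) (hcd _) hG, laplacian_comp_const_sub h2,
    laplacian_eq_sum_fderiv h2, Finset.mul_sum]
  rw [integral_finsetSum]
  · rfl
  · intro i _
    exact HasCompactSupport.convolutionExists_right (ContinuousLinearMap.mul ℝ ℝ)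
      ((hcd _).fderiv_apply (𝕜 := ℝ) _) hG
      (((hd _).continuous_fderiv (by norm_num)).clm_apply continuous_const) x

end Mollification

theorem integral_normed_sub (φ : ContDiffBump (0 : Plane)) (x : Plane) :
    ∫ z, φ.normed volume (x - z) = 1 := by
  rw [integral_sub_left_eq_self (φ.normed volume) volume x, φ.integral_normed]

/-! ### Integration by parts and test functions -/

/-- Green's first identity `∫ ∇f · ∇h = -∫ f Δh`. -/
theorem integral_fderiv_mul_fderiv_eq {f h : Plane → ℝ} (hf : ContDiff ℝ 1 f)
    (hc : HasCompactSupport f) (hh : ContDiff ℝ 2 h) :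
    ∫ x, ∑ i, fderiv ℝ f x (EuclideanSpace.basisFun (Fin 2) ℝ i)
      * fderiv ℝ h x (EuclideanSpace.basisFun (Fin 2) ℝ i) = - ∫ x, f x * (Δ h) x := by
  have hd (v : Plane) : ContDiff ℝ 1 (fun z => fderiv ℝ h z v) :=
    (hh.fderiv_right (m := 1) (by norm_num)).clm_apply contDiff_const
  have hfd (v : Plane) : Continuous (fun z => fderiv ℝ f z v) :=
    (hf.continuous_fderiv (by norm_num)).clm_apply continuous_const
  have hdd (v : Plane) : Continuous (fun x => fderiv ℝ (fun z => fderiv ℝ h z v) x v) :=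
    ((hd v).continuous_fderiv (by norm_num)).clm_apply continuous_const
  have i1 (v : Plane) : Integrable (fun x => fderiv ℝ f x v * fderiv ℝ h x v) :=
    ((hfd v).mul (hd v).continuous).integrable_of_hasCompactSupport
      ((hc.fderiv_apply (𝕜 := ℝ) v).mul_right)
  have i2 (v : Plane) : Integrable (fun x => f x * fderiv ℝ (fun z => fderiv ℝ h z v) x v) :=
    (hf.continuous.mul (hdd v)).integrable_of_hasCompactSupport hc.mul_right
  have i3 (v : Plane) : Integrable (fun x => f x * fderiv ℝ h x v) :=
    (hf.continuous.mul (hd v).continuous).integrable_of_hasCompactSupport hc.mul_right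
  simp only [laplacian_eq_sum_fderiv hh, Finset.mul_sum]
  rw [integral_finsetSum _ fun i _ => i1 _, integral_finsetSum _ fun i _ => i2 _,
    ← Finset.sum_neg_distrib]
  refine Finset.sum_congr rfl fun i _ => ?_
  rw [integral_mul_fderiv_eq_neg_fderiv_mul_of_integrable (i1 _) (i2 _) (i3 _)
    (fun x _ => (hf.differentiable (by norm_num)) x)
    (fun x _ => ((hd _).differentiable (by norm_num)) x), neg_neg]

/-- The identity `|∇(m ∘ h)|² = ∇(F ∘ h) · ∇h` for `F' = (m')²`, integrated by parts. It is applied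
with `-Δh` close to a Dirac mass, where the right-hand side is an average of `F`. -/
theorem integral_norm_gradient_comp_sq {m F : ℝ → ℝ} {h : Plane → ℝ} (hm : ContDiff ℝ 1 m)
    (hF : ContDiff ℝ 1 F) (hFm : ∀ s, deriv F s = deriv m s ^ 2) (hh : ContDiff ℝ 2 h)
    (hc : HasCompactSupport (fun x => F (h x))) :
    ∫ x, ‖gradient (fun z => m (h z)) x‖ ^ 2 = - ∫ x, F (h x) * (Δ h) x := by
  have hcomp {k : ℝ → ℝ} (hk : ContDiff ℝ 1 k) (x v : Plane) :
      fderiv ℝ (fun z => k (h z)) x v = deriv k (h x) * fderiv ℝ h x v := by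
    have h1 := ((hk.differentiable (by norm_num)) (h x)).hasDerivAt.comp_hasFDerivAt x
      ((hh.differentiable (by norm_num)) x).hasFDerivAt
    have h2 : HasFDerivAt (fun z => k (h z)) _ x := h1
    rw [h2.fderiv]; rfl
  have hFh : ContDiff ℝ 1 (fun x => F (h x)) := hF.comp (hh.of_le (by norm_num))
  rw [← integral_fderiv_mul_fderiv_eq hFh hc hh]
  refine integral_congr_ae (ae_of_all _ fun x => ?_)
  simp only [norm_gradient_sq_eq_sum]
  refine Finset.sum_congr rfl fun i _ => ?_
  rw [hcomp hm, hcomp hF, hFm]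
  ring

namespace IsTestFunction

variable {Ω : Set Plane} {φ : Plane → ℝ}

theorem continuous_gradient (h : IsTestFunction Ω φ) : Continuous (gradient φ) :=
  (InnerProductSpace.toDual ℝ Plane).symm.continuous.comp
    (h.smooth.continuous_fderiv (by simp))

theorem hasCompactSupport_gradient (h : IsTestFunction Ω φ) : HasCompactSupport (gradient φ) :=
  (h.compact_support.fderiv (𝕜 := ℝ)).comp_left (map_zero (InnerProductSpace.toDual ℝ Plane).symm)

theorem eq_zero_of_notMem (h : IsTestFunction Ω φ) {x : Plane} (hx : x ∉ Ω) : φ x = 0 :=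
  image_eq_zero_of_notMem_tsupport fun hx' => hx (h.support_subset hx')

theorem hasWeakGradient (h : IsTestFunction Ω φ) : HasWeakGradient Ω φ (gradient φ) := by
  intro ψ hψ
  rw [setIntegral_eq_integral_of_forall_compl_eq_zero
      fun x hx => by rw [h.eq_zero_of_notMem hx, zero_smul],
    setIntegral_eq_integral_of_forall_compl_eq_zero
      fun x hx => by rw [hψ.eq_zero_of_notMem hx, zero_smul]]
  have i1 : Integrable (fun x => φ x • gradient ψ x) :=
    (h.smooth.continuous.smul hψ.continuous_gradient).integrable_of_hasCompactSupport
      h.compact_support.smul_right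
  have i2 : Integrable (fun x => ψ x • gradient φ x) :=
    (hψ.smooth.continuous.smul h.continuous_gradient).integrable_of_hasCompactSupport
      hψ.compact_support.smul_right
  have i3 : Integrable (fun x => φ x * ψ x) :=
    (h.smooth.continuous.mul hψ.smooth.continuous).integrable_of_hasCompactSupport
      h.compact_support.mul_right
  refine ext_inner_left ℝ fun v => ?_
  have e (f : Plane → ℝ) (x : Plane) : inner ℝ v (gradient f x) = fderiv ℝ f x v := by
    rw [real_inner_comm, gradient, InnerProductSpace.toDual_symm_apply]
  have j1 := i1.const_inner (𝕜 := ℝ) v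
  have j2 := i2.const_inner (𝕜 := ℝ) v
  rw [inner_neg_right, ← integral_inner i1, ← integral_inner i2]
  simp only [inner_smul_right, e] at j1 j2 ⊢
  rw [integral_mul_fderiv_eq_neg_fderiv_mul_of_integrable (by simpa only [mul_comm] using j2) j1 i3
    (fun x _ => (h.smooth.differentiable (by simp)) x)
    (fun x _ => (hψ.smooth.differentiable (by simp)) x)]
  simp only [mul_comm]

/-- A test function belongs to `H¹₀`, with the constant sequence as approximation. -/
theorem memH10 (h : IsTestFunction Ω φ) : MemH10 Ω φ (gradient φ) where
  memLp := (h.smooth.continuous.memLp_of_hasCompactSupport h.compact_support).restrict Ω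
  memLp_grad := (h.continuous_gradient.memLp_of_hasCompactSupport
    h.hasCompactSupport_gradient).restrict Ω
  weak_gradient := h.hasWeakGradient
  approx := ⟨fun _ => φ, fun _ => h, by simp, by simp⟩

end IsTestFunction

/-! ### The bubble profile -/

/-- The radial bubble `2 ln ((1 + δ) / (|x|² + δ))` of the unit disc, written as a function of the
value `s = (1 / (2π)) ln (1 / |x|)` of the Green's function of the disc with pole `0`. -/
noncomputable def bubble (δ s : ℝ) : ℝ :=
  2 * Real.log ((1 + δ) / (Real.exp (-(4 * Real.pi * s)) + δ))

section Bubble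

variable {δ : ℝ}

theorem bubble_zero (hδ : 0 < δ) : bubble δ 0 = 0 := by
  have : (1 + δ) ≠ 0 := by positivity
  simp [bubble, this]

theorem bubble_mono (hδ : 0 < δ) : Monotone (bubble δ) := by
  intro s t hst
  unfold bubble
  have := Real.pi_pos
  gcongr

theorem bubble_le (hδ : 0 < δ) (s : ℝ) : bubble δ s ≤ 2 * Real.log ((1 + δ) / δ) := by
  unfold bubble
  have := Real.exp_pos (-(4 * Real.pi * s))
  gcongr
  linarith

theorem exp_bubble (hδ : 0 < δ) (s : ℝ) :
    Real.exp (bubble δ s) = ((1 + δ) / (Real.exp (-(4 * Real.pi * s)) + δ)) ^ 2 := by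
  have := Real.exp_pos (-(4 * Real.pi * s))
  rw [bubble, two_mul, Real.exp_add, Real.exp_log (by positivity), sq]

/-- The derivative of `bubble`. -/
noncomputable def bubbleDeriv (δ s : ℝ) : ℝ :=
  8 * Real.pi * Real.exp (-(4 * Real.pi * s)) / (Real.exp (-(4 * Real.pi * s)) + δ)

theorem hasDerivAt_exp_neg (s : ℝ) :
    HasDerivAt (fun s => Real.exp (-(4 * Real.pi * s)))
      (-(4 * Real.pi) * Real.exp (-(4 * Real.pi * s))) s := by
  have := (((hasDerivAt_id s).const_mul (4 * Real.pi)).neg).exp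
  simpa [mul_comm] using this

theorem hasDerivAt_bubble (hδ : 0 < δ) (s : ℝ) : HasDerivAt (bubble δ) (bubbleDeriv δ s) s := by
  have hw := Real.exp_pos (-(4 * Real.pi * s))
  have h := ((((hasDerivAt_exp_neg s).add_const δ).log (by positivity)).const_mul 2).const_sub
    (2 * Real.log (1 + δ))
  have e : (fun s => 2 * Real.log (1 + δ) - 2 * Real.log (Real.exp (-(4 * Real.pi * s)) + δ))
      = bubble δ := by
    funext t
    have := Real.exp_pos (-(4 * Real.pi * t))
    rw [bubble, Real.log_div (by positivity) (by positivity)]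
    ring
  rw [e] at h
  refine h.congr_deriv ?_
  rw [bubbleDeriv]
  ring

/-- The integral of `(bubble δ)' ^ 2` over `[0, s]`. -/
noncomputable def bubbleEnergy (δ s : ℝ) : ℝ :=
  16 * Real.pi * (Real.log (1 + δ) - Real.log (Real.exp (-(4 * Real.pi * s)) + δ)
    + δ / (1 + δ) - δ / (Real.exp (-(4 * Real.pi * s)) + δ))

theorem bubbleEnergy_zero : bubbleEnergy δ 0 = 0 := by
  simp [bubbleEnergy]

theorem hasDerivAt_bubbleEnergy (hδ : 0 < δ) (s : ℝ) :
    HasDerivAt (bubbleEnergy δ) (bubbleDeriv δ s ^ 2) s := by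
  have hw := Real.exp_pos (-(4 * Real.pi * s))
  have hne : Real.exp (-(4 * Real.pi * s)) + δ ≠ 0 := by positivity
  have h0 := (hasDerivAt_exp_neg s).add_const δ
  have h := ((((h0.log hne).const_sub (Real.log (1 + δ))).add_const (δ / (1 + δ))).sub
    ((hasDerivAt_const s δ).fun_div h0 hne)).const_mul (16 * Real.pi)
  refine h.congr_deriv ?_
  rw [bubbleDeriv]
  field_simp
  ring

/-- The bound is the limit of `bubbleEnergy δ s` as `s → ∞`, that is, the full Dirichlet integral of
the bubble on the disc. -/
theorem bubbleEnergy_le (hδ : 0 < δ) (s : ℝ) :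
    bubbleEnergy δ s ≤ 16 * Real.pi * (Real.log ((1 + δ) / δ) + δ / (1 + δ) - 1) := by
  have hmono : Monotone fun s => bubbleEnergy δ s :=
    monotone_of_deriv_nonneg (fun s => (hasDerivAt_bubbleEnergy hδ s).differentiableAt) fun s => by
      rw [(hasDerivAt_bubbleEnergy hδ s).deriv]; positivity
  have hw : Tendsto (fun s : ℝ => Real.exp (-(4 * Real.pi * s)) + δ) atTop (𝓝 δ) := by
    have h1 : Tendsto (fun s : ℝ => 4 * Real.pi * s) atTop atTop :=
      tendsto_id.const_mul_atTop (by positivity)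
    simpa using (Real.tendsto_exp_neg_atTop_nhds_zero.comp h1).add_const δ
  have hlim : Tendsto (bubbleEnergy δ) atTop
      (𝓝 (16 * Real.pi * (Real.log (1 + δ) - Real.log δ + δ / (1 + δ) - δ / δ))) :=
    ((((hw.log hδ.ne').const_sub _).add_const _).sub
      (tendsto_const_nhds.div hw hδ.ne')).const_mul _
  have := hmono.ge_of_tendsto hlim s
  rwa [div_self hδ.ne', ← Real.log_div (by positivity) (by positivity)] at this

theorem contDiff_bubbleDeriv (hδ : 0 < δ) : ContDiff ℝ ∞ (bubbleDeriv δ) := by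
  have h : ContDiff ℝ ∞ fun s => Real.exp (-(4 * Real.pi * s)) := by fun_prop
  refine (contDiff_const.mul h).div (h.add contDiff_const) fun s => ?_
  have := Real.exp_pos (-(4 * Real.pi * s))
  positivity

theorem bubbleDeriv_nonneg (hδ : 0 < δ) (s : ℝ) : 0 ≤ bubbleDeriv δ s := by
  have := Real.pi_pos
  unfold bubbleDeriv
  positivity

end Bubble

theorem hasDerivAt_integral_of_continuous {k : ℝ → ℝ} (hk : Continuous k) (s : ℝ) :
    HasDerivAt (fun s => ∫ τ in (0 : ℝ)..s, k τ) (k s) s :=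
  intervalIntegral.integral_hasDerivAt_right (hk.intervalIntegrable _ _)
    hk.stronglyMeasurable.stronglyMeasurableAtFilter hk.continuousAt

theorem contDiff_integral_of_contDiff {k : ℝ → ℝ} (hk : ContDiff ℝ ∞ k) :
    ContDiff ℝ ∞ fun s => ∫ τ in (0 : ℝ)..s, k τ := by
  have hd := hasDerivAt_integral_of_continuous hk.continuous
  rw [contDiff_infty_iff_deriv]
  refine ⟨fun s => (hd s).differentiableAt, ?_⟩
  rwa [funext fun s => (hd s).deriv]

/-- The bubble profile cut off near `s = 0`: multiplying its derivative, and not the profile itself,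
by a cutoff keeps the energy `F` below that of the bubble. -/
theorem exists_truncated_bubble {δ s₁ : ℝ} (hδ : 0 < δ) (hs₁ : 0 < s₁) :
    ∃ m F : ℝ → ℝ, ContDiff ℝ ∞ m ∧ ContDiff ℝ ∞ F ∧ (∀ s, deriv F s = deriv m s ^ 2) ∧
      (∀ s ≤ s₁ / 2, m s = 0) ∧ (∀ s ≤ s₁ / 2, F s = 0) ∧
      (∀ s, F s ≤ 16 * Real.pi * (Real.log ((1 + δ) / δ) + δ / (1 + δ) - 1)) ∧
      (∀ s, 0 ≤ s → bubble δ s - bubble δ s₁ ≤ m s) ∧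
      (∀ s, m s ≤ 2 * Real.log ((1 + δ) / δ)) := by
  set θ : ℝ → ℝ := fun τ => Real.smoothTransition (2 * τ / s₁ - 1) with hθ
  have hθs : ContDiff ℝ ∞ θ := Real.smoothTransition.contDiff.comp (by fun_prop)
  have hθ0 (τ : ℝ) (h : τ ≤ s₁ / 2) : θ τ = 0 := by
    refine Real.smoothTransition.zero_of_nonpos ?_
    rw [sub_nonpos, div_le_one hs₁]; linarith
  have hθ1 (τ : ℝ) (h : s₁ ≤ τ) : θ τ = 1 := by
    refine Real.smoothTransition.one_of_one_le ?_
    rw [le_sub_iff_add_le, le_div_iff₀ hs₁]; linarith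
  have hθn (τ : ℝ) : 0 ≤ θ τ := Real.smoothTransition.nonneg _
  have hθl (τ : ℝ) : θ τ ≤ 1 := Real.smoothTransition.le_one _
  have hb := bubbleDeriv_nonneg hδ
  set k : ℝ → ℝ := fun τ => θ τ * bubbleDeriv δ τ with hk
  have hkn (τ : ℝ) : 0 ≤ k τ := mul_nonneg (hθn τ) (hb τ)
  have hkl (τ : ℝ) : k τ ≤ bubbleDeriv δ τ := mul_le_of_le_one_left (hb τ) (hθl τ)
  have hks : ContDiff ℝ ∞ k := hθs.mul (contDiff_bubbleDeriv hδ)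
  have hks2 : ContDiff ℝ ∞ fun τ => k τ ^ 2 := hks.pow 2
  have hdm := hasDerivAt_integral_of_continuous hks.continuous
  have hdF := hasDerivAt_integral_of_continuous hks2.continuous
  set m : ℝ → ℝ := fun s => ∫ τ in (0 : ℝ)..s, k τ with hm
  set F : ℝ → ℝ := fun s => ∫ τ in (0 : ℝ)..s, k τ ^ 2 with hF
  have hzero (j : ℝ → ℝ) (hj : ∀ τ ≤ s₁ / 2, j τ = 0) (s : ℝ) (hs : s ≤ s₁ / 2) :
      ∫ τ in (0 : ℝ)..s, j τ = 0 := by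
    refine intervalIntegral.integral_zero_ae (ae_of_all _ fun τ hτ => hj τ ?_)
    have := hτ.2
    rcases le_max_iff.1 this with h | h <;> linarith
  have hk0 (τ : ℝ) (h : τ ≤ s₁ / 2) : k τ = 0 := by simp [hk, hθ0 τ h]
  have hm0 : ∀ s ≤ s₁ / 2, m s = 0 := hzero k hk0
  have hF0 : ∀ s ≤ s₁ / 2, F s = 0 := hzero _ fun τ h => by simp [hk0 τ h]
  have hz : (0 : ℝ) ≤ s₁ / 2 := by linarith
  have hmm : Monotone m := monotone_of_deriv_nonneg (fun s => (hdm s).differentiableAt) fun s => by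
    rw [(hdm s).deriv]; exact hkn s
  have hbm : Monotone fun s => bubble δ s - m s := by
    refine monotone_of_deriv_nonneg
      (fun s => ((hasDerivAt_bubble hδ s).fun_sub (hdm s)).differentiableAt) fun s => ?_
    rw [((hasDerivAt_bubble hδ s).fun_sub (hdm s)).deriv]
    exact sub_nonneg.2 (hkl s)
  have hbF : Monotone fun s => bubbleEnergy δ s - F s := by
    refine monotone_of_deriv_nonneg
      (fun s => ((hasDerivAt_bubbleEnergy hδ s).fun_sub (hdF s)).differentiableAt) fun s => ?_
    rw [((hasDerivAt_bubbleEnergy hδ s).fun_sub (hdF s)).deriv]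
    exact sub_nonneg.2 (pow_le_pow_left₀ (hkn s) (hkl s) 2)
  -- Beyond `s₁` the cutoff equals `1`, so that `m - bubble δ` is constant there.
  have hmb : MonotoneOn (fun s => m s - bubble δ s) (Ici s₁) := by
    have hd (s : ℝ) := (hdm s).fun_sub (hasDerivAt_bubble hδ s)
    refine monotoneOn_of_deriv_nonneg (convex_Ici s₁)
      (fun s _ => (hd s).continuousAt.continuousWithinAt)
      (fun s _ => (hd s).differentiableAt.differentiableWithinAt) fun s hs => ?_
    rw [interior_Ici] at hs
    rw [(hd s).deriv]
    simp [hk, hθ1 s (le_of_lt hs)]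
  refine ⟨m, F, contDiff_integral_of_contDiff hks, contDiff_integral_of_contDiff hks2,
    fun s => by rw [(hdF s).deriv, (hdm s).deriv], hm0, hF0, fun s => ?_, fun s hs => ?_,
    fun s => ?_⟩
  · rcases le_total 0 s with hs | hs
    · have h := hbF hs
      simp only [bubbleEnergy_zero, hF0 0 hz] at h
      linarith [bubbleEnergy_le hδ s]
    · rw [hF0 s (by linarith), ← bubbleEnergy_zero (δ := δ)]
      exact bubbleEnergy_le hδ 0
  · have hm00 := hm0 0 hz
    rcases le_total s s₁ with h | h
    · linarith [bubble_mono hδ h, hmm hs]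
    · have := hmb (mem_Ici.2 le_rfl) (mem_Ici.2 h) h
      simp only at this
      linarith [hmm hs₁.le]
  · have hm00 := hm0 0 hz
    have h0 := bubble_le hδ 0
    rw [bubble_zero hδ] at h0
    rcases le_total 0 s with hs | hs
    · have h := hbm hs
      simp only [bubble_zero hδ, hm00] at h
      linarith [bubble_le hδ s]
    · rw [hm0 s (by linarith)]
      exact h0

/-! ### The exponential integral of the bubble -/

theorem finrank_plane : Module.finrank ℝ Plane = 2 := by simp

/-- `∫_{|x - y| < r} dx / (C |x - y|² + δ)² = π r² / (δ (C r² + δ))`. -/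
theorem integral_ball_bubble {C δ r : ℝ} (hC : 0 < C) (hδ : 0 < δ) (hr : 0 < r) (y : Plane) :
    ∫ x in Metric.ball y r, 1 / (C * ‖x - y‖ ^ 2 + δ) ^ 2
      = Real.pi * (r ^ 2 / (δ * (C * r ^ 2 + δ))) := by
  set f : ℝ → ℝ := (Iio r).indicator fun t => 1 / (C * t ^ 2 + δ) ^ 2 with hf
  have hcongr : ∀ x : Plane, (Metric.ball y r).indicator
      (fun x => 1 / (C * ‖x - y‖ ^ 2 + δ) ^ 2) x = f ‖x - y‖ := fun x => by
    simp only [hf, indicator, Metric.mem_ball, dist_eq_norm, mem_Iio]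
  rw [← integral_indicator Metric.isOpen_ball.measurableSet, integral_congr_ae (ae_of_all _ hcongr),
    integral_sub_right_eq_self (fun x : Plane => f ‖x‖) y, integral_fun_norm_addHaar volume f,
    finrank_plane]
  have hball : volume.real (Metric.ball (0 : Plane) 1) = Real.pi := by
    simp [measureReal_def, EuclideanSpace.volume_ball_fin_two, Real.pi_pos.le]
  have hpos (t : ℝ) : 0 < C * t ^ 2 + δ := by positivity
  have hI : ∫ t in Ioi (0 : ℝ), t ^ (2 - 1) • f t
      = ∫ t in (0 : ℝ)..r, t / (C * t ^ 2 + δ) ^ 2 := by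
    rw [intervalIntegral.integral_of_le hr.le, integral_Ioc_eq_integral_Ioo,
      ← Ioi_inter_Iio, ← setIntegral_indicator measurableSet_Iio]
    refine integral_congr_ae (ae_of_all _ fun t => ?_)
    by_cases ht : t < r <;> simp [hf, ht, div_eq_mul_inv]
  have hderiv (t : ℝ) : HasDerivAt (fun t => - (1 / (2 * C)) * (C * t ^ 2 + δ)⁻¹)
      (t / (C * t ^ 2 + δ) ^ 2) t := by
    have h := (((((hasDerivAt_id t).fun_pow 2).const_mul C).add_const δ).fun_inv
      (hpos t).ne').const_mul (- (1 / (2 * C)))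
    refine h.congr_deriv ?_
    simp only [id]
    field_simp
    norm_num
  have hcont : Continuous fun t : ℝ => t / (C * t ^ 2 + δ) ^ 2 :=
    continuous_id.div (by fun_prop) fun t => (pow_pos (hpos t) 2).ne'
  rw [hI, intervalIntegral.integral_eq_sub_of_hasDerivAt (fun t _ => hderiv t)
    (hcont.intervalIntegrable _ _), hball]
  have := hpos r
  simp only [nsmul_eq_mul, smul_eq_mul]
  field_simp
  push_cast
  ring

/-! ### The mollified Green's function -/

namespace IsGreenFunction

variable {Ω : Set Plane} {y : Plane} {g : Plane → ℝ}

/-- The extension of the Green's function by zero is continuous off the pole, because of the boundary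
condition. -/
theorem continuousAt_indicator (h : IsGreenFunction Ω y g) (hΩ : IsOpen Ω) {x : Plane}
    (hxy : x ≠ y) : ContinuousAt (Ω.indicator g) x := by
  have hne : {y}ᶜ ∈ 𝓝 x := isOpen_compl_singleton.mem_nhds hxy
  by_cases hx : x ∈ Ω
  · have h1 : ContinuousAt g x := h.continuousOn.continuousAt
      (inter_mem (mem_of_superset (hΩ.mem_nhds hx) subset_closure) hne)
    exact h1.congr (eventually_of_mem (hΩ.mem_nhds hx) fun z hz => (indicator_of_mem hz g).symm)
  · rw [ContinuousAt, indicator_of_notMem hx, ← nhdsWithin_univ, ← union_compl_self Ω,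
      nhdsWithin_union, tendsto_sup]
    constructor
    · refine Tendsto.congr' (f₁ := g)
        (eventually_of_mem self_mem_nhdsWithin fun z hz => (indicator_of_mem hz g).symm) ?_
      by_cases hc : x ∈ closure Ω
      · have h0 : g x = 0 := h.eq_zero_on_boundary x ⟨hc, by rwa [hΩ.interior_eq]⟩
        have h1 : Tendsto g _ _ := h.continuousOn x ⟨hc, hxy⟩
        rw [h0] at h1
        refine h1.mono_left (nhdsWithin_le_iff.2 ?_)
        exact inter_mem (mem_of_superset self_mem_nhdsWithin subset_closure)
          (mem_nhdsWithin_of_mem_nhds hne)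
      · rw [notMem_closure_iff_nhdsWithin_eq_bot.1 hc]
        exact tendsto_bot
    · exact tendsto_const_nhds.congr'
        (eventually_of_mem self_mem_nhdsWithin fun z hz => (indicator_of_notMem hz g).symm)

theorem integrable_indicator (h : IsGreenFunction Ω y g) (hΩ : IsOpen Ω)
    (hb : Bornology.IsBounded Ω) (hy : y ∈ Ω) : Integrable (Ω.indicator g) := by
  obtain ⟨U, hU, hgU⟩ := h.locallyIntegrable y hy
  rw [hΩ.nhdsWithin_eq hy] at hU
  obtain ⟨V, hVU, hV, hyV⟩ := mem_nhds_iff.1 hU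
  have hK : IsCompact (closure Ω \ V) := hb.isCompact_closure.diff hV
  have hgK : IntegrableOn g (closure Ω \ V) :=
    (h.continuousOn.mono fun z hz => ⟨hz.1, fun e => hz.2 (e ▸ hyV)⟩).integrableOn_compact hK
  rw [integrable_indicator_iff hΩ.measurableSet]
  refine (hgU.union hgK).mono_set fun z hz => ?_
  by_cases hzV : z ∈ V
  · exact Or.inl (hVU hzV)
  · exact Or.inr ⟨subset_closure hz, hzV⟩

theorem integral_indicator_mul_laplacian (h : IsGreenFunction Ω y g) (hΩ : IsOpen Ω)
    {φ : Plane → ℝ} (hφ : IsTestFunction Ω φ) :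
    ∫ z, Ω.indicator g z * (Δ φ) z = - φ y := by
  rw [← h.neg_laplacian_eq_dirac φ hφ, ← integral_neg, ← integral_indicator hΩ.measurableSet]
  refine integral_congr_ae (ae_of_all _ fun z => ?_)
  by_cases hz : z ∈ Ω <;> simp [hz]

/-- Away from the boundary, mollifying the Green's function turns the Dirac mass in its equation
into the mollifier. -/
theorem laplacian_mollification_eq (h : IsGreenFunction Ω y g) (hΩ : IsOpen Ω)
    (hb : Bornology.IsBounded Ω) (hy : y ∈ Ω) (φ : ContDiffBump (0 : Plane)) {x : Plane}
    (hx : Metric.closedBall x φ.rOut ⊆ Ω) :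
    (Δ (mollification (φ.normed volume) (Ω.indicator g))) x = - φ.normed volume (x - y) := by
  rw [laplacian_mollification φ.contDiff_normed φ.hasCompactSupport_normed
    (h.integrable_indicator hΩ hb hy).locallyIntegrable]
  have hsupp : tsupport (fun w => φ.normed volume (x - w)) ⊆ Metric.closedBall x φ.rOut := by
    refine closure_minimal (fun w hw => ?_) Metric.isClosed_closedBall
    have : x - w ∈ Function.support (φ.normed volume) := hw
    rw [φ.support_normed_eq, mem_ball_zero_iff] at this
    rw [mem_closedBall_iff_norm']
    exact this.le
  refine h.integral_indicator_mul_laplacian hΩ (φ := fun w => φ.normed volume (x - w))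
    ⟨φ.contDiff_normed.comp (contDiff_const.sub contDiff_id), ?_, hsupp.trans hx⟩
  exact HasCompactSupport.of_support_subset_isCompact (isCompact_closedBall x φ.rOut)
    ((subset_tsupport _).trans hsupp)

/-- Since the Green's function vanishes on the boundary, the positive superlevel sets of its
mollifications at small scales stay in a fixed compact subset of `Ω`. -/
theorem exists_isCompact_superlevel (h : IsGreenFunction Ω y g) (hΩ : IsOpen Ω)
    (hb : Bornology.IsBounded Ω) (hy : y ∈ Ω) {s₀ : ℝ} (hs₀ : 0 < s₀) :
    ∃ κ > 0, ∃ K : Set Plane, IsCompact K ∧ K ⊆ Ω ∧ ∀ φ : ContDiffBump (0 : Plane), φ.rOut ≤ κ →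
      ∀ x, s₀ ≤ mollification (φ.normed volume) (Ω.indicator g) x →
        x ∈ K ∧ Metric.closedBall x φ.rOut ⊆ Ω := by
  -- The pole is added by hand, the value of `g` there being arbitrary.
  set L : Set Plane := {x | x = y ∨ s₀ / 2 ≤ Ω.indicator g x} with hL
  have hLΩ : L ⊆ Ω := by
    rintro x (rfl | hx)
    · exact hy
    · by_contra hxΩ
      rw [indicator_of_notMem hxΩ] at hx
      linarith
  have hLc : IsClosed L := by
    rw [← isOpen_compl_iff, isOpen_iff_mem_nhds]
    intro x hx
    have hx' : x ≠ y ∧ Ω.indicator g x < s₀ / 2 := by simpa [hL] using hx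
    filter_upwards [isOpen_compl_singleton.mem_nhds hx'.1,
      (h.continuousAt_indicator hΩ hx'.1).eventually (gt_mem_nhds hx'.2)] with z hz1 hz2
    simpa [hL] using And.intro hz1 hz2
  have hLK : IsCompact L := Metric.isCompact_of_isClosed_isBounded hLc (hb.subset hLΩ)
  obtain ⟨κ, hκ, hsub⟩ := hLK.exists_cthickening_subset_open hΩ hLΩ
  have hmono : Metric.cthickening (κ / 2) L ⊆ Ω :=
    (Metric.cthickening_mono (by linarith) _).trans hsub
  refine ⟨κ / 2, by positivity, Metric.cthickening (κ / 2) L, hLK.cthickening, hmono,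
    fun φ hφ x hx => ?_⟩
  -- Otherwise `G < s₀ / 2` on the whole ball over which `G` is averaged.
  obtain ⟨z, hzL, hzx⟩ : ∃ z ∈ L, dist x z < φ.rOut := by
    by_contra! hcon
    have hint : Integrable fun z => Ω.indicator g z * φ.normed volume (x - z) :=
      HasCompactSupport.convolutionExists_right (ContinuousLinearMap.mul ℝ ℝ)
        φ.hasCompactSupport_normed (h.integrable_indicator hΩ hb hy).locallyIntegrable
        φ.continuous_normed x
    have hint' : Integrable fun z => s₀ / 2 * φ.normed volume (x - z) :=
      (φ.integrable_normed.comp_sub_left x).const_mul _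
    have hle : mollification (φ.normed volume) (Ω.indicator g) x
        ≤ ∫ z, s₀ / 2 * φ.normed volume (x - z) := by
      refine integral_mono hint hint' fun z => ?_
      by_cases hz : z ∈ L
      · have h0 : φ.normed volume (x - z) = 0 := by
          rw [← Function.notMem_support, φ.support_normed_eq, mem_ball_zero_iff, not_lt,
            ← dist_eq_norm]
          exact hcon z hz
        simp [h0]
      · have hz' : z ≠ y ∧ Ω.indicator g z < s₀ / 2 := by simpa [hL] using hz
        exact mul_le_mul_of_nonneg_right hz'.2.le (φ.nonneg_normed _)
    rw [integral_const_mul, integral_normed_sub] at hle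
    linarith
  refine ⟨Metric.mem_cthickening_of_dist_le x z _ L hzL (hzx.le.trans hφ), fun w hw => hsub ?_⟩
  refine Metric.mem_cthickening_of_dist_le w z _ L hzL ?_
  linarith [dist_triangle w x z, Metric.mem_closedBall.1 hw]

theorem isTestFunction_comp_mollification (h : IsGreenFunction Ω y g) (hΩ : IsOpen Ω)
    (hb : Bornology.IsBounded Ω) (hy : y ∈ Ω) {s₀ : ℝ} {φ : ContDiffBump (0 : Plane)}
    {K : Set Plane} (hK : IsCompact K) (hKΩ : K ⊆ Ω)
    (hsup : ∀ x, s₀ ≤ mollification (φ.normed volume) (Ω.indicator g) x → x ∈ K)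
    {m : ℝ → ℝ} (hm : ContDiff ℝ ∞ m) (hm0 : ∀ s ≤ s₀, m s = 0) :
    IsTestFunction Ω fun x => m (mollification (φ.normed volume) (Ω.indicator g) x) := by
  have hsupp : Function.support
      (fun x => m (mollification (φ.normed volume) (Ω.indicator g) x)) ⊆ K := fun x hx =>
    hsup x (le_of_not_ge fun hlt => hx (hm0 _ hlt))
  exact ⟨hm.comp (contDiff_mollification φ.contDiff_normed φ.hasCompactSupport_normed
      (h.integrable_indicator hΩ hb hy).locallyIntegrable),
    HasCompactSupport.of_support_subset_isCompact hK hsupp,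
    (closure_minimal hsupp hK.isClosed).trans hKΩ⟩

/-- Testing `-Δ h = φ(· - y)`, for the mollified Green's function `h`, against `F ∘ h` bounds the
Dirichlet integral of `m ∘ h` by `sup F`. -/
theorem integral_norm_gradient_sq_le (h : IsGreenFunction Ω y g) (hΩ : IsOpen Ω)
    (hb : Bornology.IsBounded Ω) (hy : y ∈ Ω) {s₀ A : ℝ} {φ : ContDiffBump (0 : Plane)}
    {K : Set Plane} (hK : IsCompact K) (hKΩ : K ⊆ Ω)
    (hsup : ∀ x, s₀ ≤ mollification (φ.normed volume) (Ω.indicator g) x →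
      x ∈ K ∧ Metric.closedBall x φ.rOut ⊆ Ω)
    {m F : ℝ → ℝ} (hm : ContDiff ℝ ∞ m) (hF : ContDiff ℝ ∞ F)
    (hFm : ∀ s, deriv F s = deriv m s ^ 2) (hm0 : ∀ s ≤ s₀, m s = 0) (hF0 : ∀ s ≤ s₀, F s = 0)
    (hFA : ∀ s, F s ≤ A) :
    ∫ x in Ω, ‖gradient (fun z => m (mollification (φ.normed volume) (Ω.indicator g) z)) x‖ ^ 2
      ≤ A := by
  set H := mollification (φ.normed volume) (Ω.indicator g) with hH
  have hmt : IsTestFunction Ω fun x => m (H x) :=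
    h.isTestFunction_comp_mollification hΩ hb hy hK hKΩ (fun x hx => (hsup x hx).1) hm hm0
  have hFt : IsTestFunction Ω fun x => F (H x) :=
    h.isTestFunction_comp_mollification hΩ hb hy hK hKΩ (fun x hx => (hsup x hx).1) hF hF0
  have hHs : ContDiff ℝ ∞ H := contDiff_mollification φ.contDiff_normed φ.hasCompactSupport_normed
      (h.integrable_indicator hΩ hb hy).locallyIntegrable
  have hgrad (x : Plane) (hx : x ∉ Ω) : gradient (fun z => m (H z)) x = 0 := by
    rw [gradient, fderiv_of_notMem_tsupport ℝ fun hx' => hx (hmt.support_subset hx'), map_zero]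
  rw [setIntegral_eq_integral_of_forall_compl_eq_zero fun x hx => by rw [hgrad x hx]; simp,
    integral_norm_gradient_comp_sq (contDiff_infty.1 hm 1) (contDiff_infty.1 hF 1) hFm
      (contDiff_infty.1 hHs 2) hFt.compact_support, ← integral_neg]
  have hcongr : ∀ x, -(F (H x) * (Δ H) x) = F (H x) * φ.normed volume (x - y) := fun x => by
    rcases le_total (H x) s₀ with hx | hx
    · simp [hF0 _ hx]
    · rw [hH, h.laplacian_mollification_eq hΩ hb hy φ (hsup x hx).2]
      ring
  rw [integral_congr_ae (ae_of_all _ hcongr)]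
  have hi : Integrable fun x => φ.normed volume (x - y) := φ.integrable_normed.comp_sub_right y
  calc ∫ x, F (H x) * φ.normed volume (x - y)
      ≤ ∫ x, A * φ.normed volume (x - y) := by
        refine integral_mono ?_ (hi.const_mul A) fun x =>
          mul_le_mul_of_nonneg_right (hFA _) (φ.nonneg_normed _)
        exact (hFt.smooth.continuous.mul (φ.continuous_normed.comp
          (continuous_id.sub continuous_const))).integrable_of_hasCompactSupport
          hFt.compact_support.mul_right
    _ = A := by
        rw [integral_const_mul, integral_sub_right_eq_self (φ.normed volume) y, φ.integral_normed,
          mul_one]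

theorem tendsto_mollification (h : IsGreenFunction Ω y g) (hΩ : IsOpen Ω)
    (hb : Bornology.IsBounded Ω) (hy : y ∈ Ω) {φ : ℕ → ContDiffBump (0 : Plane)}
    (hφ : Tendsto (fun n => (φ n).rOut) atTop (𝓝 0)) {x : Plane} (hxy : x ≠ y) :
    Tendsto (fun n => mollification ((φ n).normed volume) (Ω.indicator g) x) atTop
      (𝓝 (Ω.indicator g x)) := by
  have := ContDiffBump.convolution_tendsto_right (μ := (volume : Measure Plane)) (φ := φ)
    (g := fun _ => Ω.indicator g) (k := fun _ => x) hφ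
    (Eventually.of_forall fun _ => (h.integrable_indicator hΩ hb hy).aestronglyMeasurable)
    ((h.continuousAt_indicator hΩ hxy).tendsto.comp tendsto_snd) tendsto_const_nhds
  refine this.congr fun n => ?_
  rw [convolution_lsmul_swap]
  simp only [mollification, smul_eq_mul, mul_comm]

/-- The mean field energy is bounded by the value of the functional at `m ∘ g`, where
the Dirichlet integral is replaced by `A ≥ ∫ (m')²`. -/
theorem meanFieldEnergy_le (h : IsGreenFunction Ω y g) (hΩ : IsOpen Ω)
    (hb : Bornology.IsBounded Ω) (hy : y ∈ Ω) {lam s₀ A M : ℝ} (hlam : 0 < lam) (hs₀ : 0 < s₀)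
    {m F : ℝ → ℝ} (hm : ContDiff ℝ ∞ m) (hF : ContDiff ℝ ∞ F)
    (hFm : ∀ s, deriv F s = deriv m s ^ 2) (hm0 : ∀ s ≤ s₀, m s = 0) (hF0 : ∀ s ≤ s₀, F s = 0)
    (hFA : ∀ s, F s ≤ A) (hmM : ∀ s, m s ≤ M) :
    IntegrableOn (fun x => Real.exp (m (g x))) Ω ∧ meanFieldEnergy lam Ω ≤
      ((1 / (2 * lam) * A - Real.log (1 / volume.real Ω * ∫ x in Ω, Real.exp (m (g x))) : ℝ) :
        EReal) := by
  have hfin : volume Ω < ⊤ := hb.measure_lt_top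
  have hpos : 0 < volume Ω := hΩ.measure_pos volume ⟨y, hy⟩
  have hcm : Continuous fun s => Real.exp (m s) := Real.continuous_exp.comp hm.continuous
  have hbd (s : ℝ) : ‖Real.exp (m s)‖ ≤ Real.exp M := by
    rw [Real.norm_eq_abs, Real.abs_exp]; exact Real.exp_le_exp.2 (hmM s)
  have hint : IntegrableOn (fun x => Real.exp (m (g x))) Ω := by
    have hmeas : AEStronglyMeasurable g (volume.restrict Ω) :=
      ((integrable_indicator_iff hΩ.measurableSet).1
        (h.integrable_indicator hΩ hb hy)).aestronglyMeasurable
    have : IsFiniteMeasure (volume.restrict Ω) := ⟨by simpa using hfin⟩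
    exact Integrable.of_bound (hcm.comp_aestronglyMeasurable hmeas) (Real.exp M)
      (ae_of_all _ fun x => hbd _)
  refine ⟨hint, ?_⟩
  obtain ⟨κ, hκ, K, hK, hKΩ, hsup⟩ := h.exists_isCompact_superlevel hΩ hb hy hs₀
  let φ : ℕ → ContDiffBump (0 : Plane) := fun n =>
    ⟨1 / ((n : ℝ) + 1) / 2, 1 / ((n : ℝ) + 1), by positivity, half_lt_self (by positivity)⟩
  have hφ : Tendsto (fun n => (φ n).rOut) atTop (𝓝 0) := tendsto_one_div_add_atTop_nhds_zero_nat
  have hne : ∀ᵐ x ∂volume.restrict Ω, x ≠ y :=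
    ae_restrict_of_ae (by simp [ae_iff])
  have hlim : Tendsto (fun n => ∫ x in Ω,
      Real.exp (m (mollification ((φ n).normed volume) (Ω.indicator g) x))) atTop
      (𝓝 (∫ x in Ω, Real.exp (m (g x)))) := by
    refine tendsto_integral_of_dominated_convergence (fun _ => Real.exp M) (fun n => ?_)
      (integrableOn_const hfin.ne) (fun n => ae_of_all _ fun x => hbd _) ?_
    · exact (hcm.comp (contDiff_mollification (φ n).contDiff_normed
        (φ n).hasCompactSupport_normed
        (h.integrable_indicator hΩ hb hy).locallyIntegrable).continuous).aestronglyMeasurable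
    · filter_upwards [hne, ae_restrict_mem hΩ.measurableSet] with x hx hxΩ
      have := h.tendsto_mollification hΩ hb hy hφ hx
      rw [indicator_of_mem hxΩ] at this
      exact (hcm.tendsto _).comp this
  have hIpos : 0 < ∫ x in Ω, Real.exp (m (g x)) := by
    have : NeZero (volume.restrict Ω) := ⟨by simpa using hpos.ne'⟩
    exact integral_exp_pos hint
  have hVpos : 0 < volume.real Ω := ENNReal.toReal_pos hpos.ne' hfin.ne
  refine ge_of_tendsto (continuous_coe_real_ereal.continuousAt.tendsto.comp
    (((hlim.const_mul (1 / volume.real Ω)).log (by positivity)).const_sub (1 / (2 * lam) * A))) ?_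
  filter_upwards [hφ.eventually (gt_mem_nhds hκ)] with n hn
  have hs := hsup (φ n) hn.le
  have ht := h.isTestFunction_comp_mollification hΩ hb hy hK hKΩ (fun x hx => (hs x hx).1) hm hm0
  have hle : meanFieldEnergy lam Ω ≤ (meanFieldFunctional lam Ω _ _ : ℝ) :=
    iInf_le_of_le _ (iInf_le_of_le _ (iInf_le _ ht.memH10))
  refine hle.trans ?_
  rw [Function.comp_apply, EReal.coe_le_coe_iff]
  unfold meanFieldFunctional
  have hD := h.integral_norm_gradient_sq_le hΩ hb hy hK hKΩ hs hm hF hFm hm0 hF0 hFA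
  gcongr

end IsGreenFunction

/-! ### Concentrating the bubble at a point -/

/-- Near its pole, `exp (-4πg)` is at most `e^{-4π(t - η)} |x - y|²`, where `t` is the value of the
regular part at the pole. -/
theorem exists_ball_exp_green_le {Ω : Set Plane} {y : Plane} {g : Plane → ℝ} {t η : ℝ}
    (hΩ : IsOpen Ω) (hy : y ∈ Ω) (hη : 0 < η)
    (hlim : Tendsto (fun x => g x - 1 / (2 * Real.pi) * Real.log (1 / ‖x - y‖)) (𝓝[≠] y) (𝓝 t)) :
    ∃ r > 0, Metric.ball y r ⊆ Ω ∧ ∀ x ∈ Metric.ball y r, x ≠ y → 0 ≤ g x ∧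
      Real.exp (-(4 * Real.pi * g x)) ≤ Real.exp (-(4 * Real.pi * (t - η))) * ‖x - y‖ ^ 2 := by
  have h1 : ∀ᶠ x in 𝓝 y, x ≠ y →
      t - η < g x - 1 / (2 * Real.pi) * Real.log (1 / ‖x - y‖) :=
    eventually_nhdsWithin_iff.1 (hlim.eventually (lt_mem_nhds (by linarith)))
  obtain ⟨r₁, hr₁, h1⟩ := Metric.eventually_nhds_iff_ball.1 h1
  obtain ⟨r₂, hr₂, h2⟩ := Metric.isOpen_iff.1 hΩ y hy
  have hπ := Real.pi_pos
  refine ⟨min (min r₁ r₂) (Real.exp (2 * Real.pi * (t - η))), by positivity,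
    (Metric.ball_subset_ball ((min_le_left _ _).trans (min_le_right _ _))).trans h2,
    fun x hx hxy => ?_⟩
  have hn : 0 < ‖x - y‖ := norm_sub_pos_iff.2 hxy
  rw [Metric.mem_ball, dist_eq_norm, lt_min_iff, lt_min_iff] at hx
  have h3 := h1 x (by rw [Metric.mem_ball, dist_eq_norm]; exact hx.1.1) hxy
  have h4 := Real.log_lt_log hn hx.2
  rw [Real.log_exp] at h4
  rw [one_div ‖x - y‖, Real.log_inv] at h3
  have h5 : 2 * Real.pi * (t - η) - Real.log ‖x - y‖ < 2 * Real.pi * g x := by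
    have := mul_lt_mul_of_pos_left h3 (by positivity : 0 < 2 * Real.pi)
    have e : 2 * Real.pi * (g x - 1 / (2 * Real.pi) * -Real.log ‖x - y‖)
        = 2 * Real.pi * g x + Real.log ‖x - y‖ := by field_simp; ring
    linarith
  constructor
  · have : 0 < 2 * Real.pi * g x := by linarith
    exact (pos_of_mul_pos_right this (by positivity)).le
  · rw [← Real.exp_log (pow_pos hn 2), ← Real.exp_add, Real.exp_le_exp, Real.log_pow]
    push_cast
    linarith

/-- The energy bound given by the bubble of scale `δ` concentrated at `y` and cut off at the level
`s₁`. Its Dirichlet term and the logarithm of its exponential integral both grow like `ln (1 / δ)`,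
and the two divergences cancel. -/
theorem meanFieldEnergy_le_of_bubble {Ω : Set Plane} {y : Plane} {g : Plane → ℝ} {C r δ s₁ : ℝ}
    (hΩ : IsOpen Ω) (hb : Bornology.IsBounded Ω) (harea : volume.real Ω = Real.pi) (hy : y ∈ Ω)
    (h : IsGreenFunction Ω y g) (hC : 0 < C) (hr : 0 < r) (hδ : 0 < δ) (hs₁ : 0 < s₁)
    (hball : Metric.ball y r ⊆ Ω) (hg : ∀ x ∈ Metric.ball y r, x ≠ y → 0 ≤ g x ∧
      Real.exp (-(4 * Real.pi * g x)) ≤ C * ‖x - y‖ ^ 2) :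
    meanFieldEnergy (8 * Real.pi) Ω ≤
      ((-1 + δ + Real.log (C + δ / r ^ 2) + bubble δ s₁ : ℝ) : EReal) := by
  have hπ := Real.pi_pos
  obtain ⟨m, F, hm, hF, hFm, hm0, hF0, hFA, hmb, hmM⟩ := exists_truncated_bubble hδ hs₁
  obtain ⟨hint, hE⟩ := h.meanFieldEnergy_le hΩ hb hy (lam := 8 * Real.pi) (by positivity)
    (half_pos hs₁) hm hF hFm hm0 hF0 hFA hmM
  refine hE.trans (EReal.coe_le_coe_iff.2 ?_)
  set Q := Real.exp (-bubble δ s₁) * (1 + δ) ^ 2 with hQ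
  have hlow : Q * (Real.pi * (r ^ 2 / (δ * (C * r ^ 2 + δ)))) ≤ ∫ x in Ω, Real.exp (m (g x)) := by
    rw [← integral_ball_bubble hC hδ hr y, ← integral_const_mul]
    refine le_trans ?_ (setIntegral_mono_set hint (ae_of_all _ fun x => (Real.exp_pos _).le)
      hball.eventuallyLE)
    refine setIntegral_mono_ae_restrict ?_ (hint.mono_set hball) ?_
    · have hc : Continuous fun x : Plane => Q * (1 / (C * ‖x - y‖ ^ 2 + δ) ^ 2) := by
        refine continuous_const.mul (continuous_const.div (by fun_prop) fun x => ?_)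
        positivity
      exact (hc.continuousOn.integrableOn_compact (isCompact_closedBall y r)).mono_set
        Metric.ball_subset_closedBall
    · filter_upwards [ae_restrict_mem Metric.isOpen_ball.measurableSet,
        ae_restrict_of_ae (show ∀ᵐ x : Plane, x ≠ y by simp [ae_iff])] with x hx hxy
      obtain ⟨h0, h1⟩ := hg x hx hxy
      have he := Real.exp_pos (-(4 * Real.pi * g x))
      calc Q * (1 / (C * ‖x - y‖ ^ 2 + δ) ^ 2)
          = Real.exp (-bubble δ s₁) * ((1 + δ) / (C * ‖x - y‖ ^ 2 + δ)) ^ 2 := by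
            rw [hQ, div_pow]; ring
        _ ≤ Real.exp (-bubble δ s₁) * Real.exp (bubble δ (g x)) := by
            rw [exp_bubble hδ]
            gcongr
        _ ≤ Real.exp (m (g x)) := by
            rw [← Real.exp_add, Real.exp_le_exp]
            linarith [hmb _ h0]
  have hlog : -bubble δ s₁ + 2 * Real.log (1 + δ) - Real.log δ - Real.log (C + δ / r ^ 2)
      ≤ Real.log (1 / volume.real Ω * ∫ x in Ω, Real.exp (m (g x))) := by
    have e : -bubble δ s₁ + 2 * Real.log (1 + δ) - Real.log δ - Real.log (C + δ / r ^ 2)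
        = Real.log (1 / volume.real Ω * (Q * (Real.pi * (r ^ 2 / (δ * (C * r ^ 2 + δ)))))) := by
      have e1 : 1 / volume.real Ω * (Q * (Real.pi * (r ^ 2 / (δ * (C * r ^ 2 + δ)))))
          = Real.exp (-bubble δ s₁) * (1 + δ) ^ 2 / δ / (C + δ / r ^ 2) := by
        rw [hQ, harea]
        field_simp
      rw [e1, Real.log_div (by positivity) (by positivity),
        Real.log_div (by positivity) (by positivity),
        Real.log_mul (by positivity) (by positivity), Real.log_exp, Real.log_pow]
      push_cast
      ring
    rw [e]
    refine Real.log_le_log ?_ (mul_le_mul_of_nonneg_left hlow (by positivity))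
    rw [harea, hQ]
    positivity
  have hl : Real.log ((1 + δ) / δ) = Real.log (1 + δ) - Real.log δ :=
    Real.log_div (by positivity) hδ.ne'
  have hl0 : 0 ≤ Real.log (1 + δ) := Real.log_nonneg (by linarith)
  have hd : δ / (1 + δ) ≤ δ := div_le_self hδ.le (by linarith)
  have hA : 1 / (2 * (8 * Real.pi)) *
      (16 * Real.pi * (Real.log ((1 + δ) / δ) + δ / (1 + δ) - 1))
      = Real.log ((1 + δ) / δ) + δ / (1 + δ) - 1 := by
    field_simp
    ring
  rw [hA, hl]
  linarith

/-- The pointwise form of the estimate: each value `t = γ(y, y)` gives `E ≤ -1 - 4πt`. -/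
theorem meanFieldEnergy_le_of_isRegularPartAt {Ω : Set Plane} (hΩ : IsOpen Ω)
    (hb : Bornology.IsBounded Ω) (harea : volume.real Ω = Real.pi) {y : Plane} (hy : y ∈ Ω) {t : ℝ}
    (ht : IsRegularPartAt Ω y t) :
    meanFieldEnergy (8 * Real.pi) Ω ≤ ((-1 - 4 * Real.pi * t : ℝ) : EReal) := by
  obtain ⟨g, hg, hlim⟩ := ht
  have hcoe {f : ℝ → ℝ} {b : ℝ} (hf : Tendsto f (𝓝[>] 0) (𝓝 b))
      (hle : ∀ a > 0, meanFieldEnergy (8 * Real.pi) Ω ≤ ((f a : ℝ) : EReal)) :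
      meanFieldEnergy (8 * Real.pi) Ω ≤ (b : EReal) :=
    ge_of_tendsto (continuous_coe_real_ereal.continuousAt.tendsto.comp hf)
      (eventually_of_mem self_mem_nhdsWithin hle)
  -- The three limits are taken one inside the other: the cutoff level `s₁` first, then the scale
  -- `δ`, and last the error `η` in the expansion of the Green's function at its pole.
  refine hcoe (f := fun η => -1 - 4 * Real.pi * (t - η)) ?_ fun η hη => ?_
  · have hc : Continuous fun η : ℝ => -1 - 4 * Real.pi * (t - η) := by fun_prop
    simpa using (hc.tendsto 0).mono_left nhdsWithin_le_nhds
  obtain ⟨r, hr, hball, hgr⟩ := exists_ball_exp_green_le hΩ hy hη hlim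
  set C := Real.exp (-(4 * Real.pi * (t - η))) with hC
  have hC0 : 0 < C := Real.exp_pos _
  refine hcoe (f := fun δ => -1 + δ + Real.log (C + δ / r ^ 2)) ?_ fun δ hδ => ?_
  · have hc : ContinuousAt (fun δ : ℝ => -1 + δ + Real.log (C + δ / r ^ 2)) 0 := by
      refine (by fun_prop : ContinuousAt (fun δ : ℝ => -1 + δ) 0).add (ContinuousAt.log ?_ ?_)
      · fun_prop
      · simpa using hC0.ne'
    have := hc.tendsto.mono_left (nhdsWithin_le_nhds (s := Ioi 0))
    simpa [hC, sub_eq_add_neg] using this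
  refine hcoe (f := fun s₁ => -1 + δ + Real.log (C + δ / r ^ 2) + bubble δ s₁) ?_ fun s₁ hs₁ =>
    meanFieldEnergy_le_of_bubble hΩ hb harea hy hg hC0 hr hδ hs₁ hball hgr
  have := ((hasDerivAt_bubble hδ 0).continuousAt.tendsto.mono_left
    (nhdsWithin_le_nhds (s := Ioi 0))).const_add (-1 + δ + Real.log (C + δ / r ^ 2))
  simpa [bubble_zero hδ] using this

theorem proposition3p1 (Ω : Set Plane) (hΩ : IsBoundedSmoothDomain Ω)
    (harea : volume Ω = ENNReal.ofReal Real.pi) :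
    meanFieldEnergy (8 * Real.pi) Ω ≤
      (-1 : EReal) - ((4 * Real.pi : ℝ) : EReal) * gammaSup Ω := by
  have hπ : (0 : ℝ) < 4 * Real.pi := by positivity
  have hareaR : volume.real Ω = Real.pi := by
    rw [measureReal_def, harea, ENNReal.toReal_ofReal Real.pi_pos.le]
  have key {y : Plane} (hy : y ∈ Ω) {t : ℝ} (ht : IsRegularPartAt Ω y t) :=
    meanFieldEnergy_le_of_isRegularPartAt hΩ.isOpen hΩ.isBounded hareaR hy ht
  induction hE : meanFieldEnergy (8 * Real.pi) Ω with
  | bot => exact bot_le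
  | top =>
    -- By the pointwise estimate, this happens only if no regular part exists.
    have hγ : gammaSup Ω = ⊥ := by
      refine le_bot_iff.1 (iSup₂_le fun y hy => iSup₂_le fun t ht => ?_)
      have := key hy ht
      rw [hE] at this
      exact absurd (top_le_iff.1 this) (EReal.coe_ne_top _)
    rw [hγ, EReal.coe_mul_bot_of_pos hπ]
    exact le_top
  | coe e =>
    have hγ : gammaSup Ω ≤ (((-1 - e) / (4 * Real.pi) : ℝ) : EReal) := by
      refine iSup₂_le fun y hy => iSup₂_le fun t ht => EReal.coe_le_coe_iff.2 ?_
      have := key hy ht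
      rw [hE, EReal.coe_le_coe_iff] at this
      rw [le_div_iff₀ hπ]
      linarith
    have h1 : ((4 * Real.pi : ℝ) : EReal) * gammaSup Ω ≤ ((-1 - e : ℝ) : EReal) := by
      refine (mul_le_mul_of_nonneg_left hγ (EReal.coe_nonneg.2 hπ.le)).trans (le_of_eq ?_)
      rw [← EReal.coe_mul, mul_div_cancel₀ _ hπ.ne']
    refine le_trans (le_of_eq ?_) (EReal.sub_le_sub le_rfl h1)
    have : (-1 : EReal) = ((-1 : ℝ) : EReal) := by simp
    rw [this, ← EReal.coe_sub]
    congr 1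
    ring
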